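/- A finite metric graph $G$ consists of a finite set $V$ of vertices, a finite set $E$ of edges (loops, parallel edges and several components are allowed) and a length function $L:E\to(0,\infty)$, where each edge $e$ is identified with the interval $[0,L(e)]$, its endpoints $0$ and $L(e)$ being identified with the vertices $o(e)$ and $t(e)$, respectively. The Kirchhoff Laplacian $-\Delta_G$ in $L^2(G)=\bigoplus_{e\in E}L^2(0,L(e))$ (complex-valued functions) acts as $(-\Delta_G f)_e=-f_e''$ on those $f$ with $f_e\in H^2(0,L(e))$ for all $e\in E$ which are continuous at each vertex and satisfy $$\sum_{t(e)=v}f_e'(L(e))-\sum_{o(e)=v}f_e'(0)=0\qquad\text{for all } v\in V.$$ For $\lambda\in\mathbb R$ let $$R(G,\lambda)=\{f\in\ker(-\Delta_G-\lambda): f(v)=0\ \text{for all}\ v\in V\},$$ and call $\lambda$ a real resonance of $G$ if $R(G,\lambda)\neq\{0\}$. **Theorem.** Let $G$ be a finite metric graph and let $\lambda>0$. Let $G_\lambda$ be the subgraph of $G$ consisting of all edges whose lengths are natural multiples of $\pi/\sqrt\lambda$ (and their endpoints). Let $\beta_1(G_\lambda)=|E(G_\lambda)|-|V(G_\lambda)|+\beta_0(G_\lambda)$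 be its first Betti number, where $\beta_0(G_\lambda)$ is its number of connected components, and let $\beta_0^{\rm odd}(G_\lambda)$ be the number of connected components of $G_\lambda$ which contain a cycle whose length is an odd multiple of $\pi/\sqrt\lambda$. Then $R(G,\lambda)$ is finite-dimensional and $$\dim R(G,\lambda)=\beta_1(G_\lambda)-\beta_0^{\rm odd}(G_\lambda).$$ In particular, $\lambda$ is a real resonance of $G$ if and only if $\beta_1(G_\lambda)-\beta_0^{\rm odd}(G_\lambda)>0$. -/

import Mathlib

open MeasureTheory
open scoped ContDiff

noncomputable section

/-- A metric graph with vertices `V` and edges `E` (finite as soon as `V` and `E` are finite).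
Loops, parallel edges, isolated vertices and several components are allowed. The edge `e` is the
interval `[0, L e]`, with `0` identified with the vertex `o e` and `L e` with the vertex `t e`. -/
structure MetricGraph (V E : Type*) where
  o : E → V
  t : E → V
  L : E → ℝ
  L_pos : ∀ e, 0 < L e

namespace MetricGraph

/-! ### Sobolev functions on an interval -/

/-- The Hilbert space `L²(0, ℓ)` of complex-valued functions. -/
abbrev L2Edge (ℓ : ℝ) : Type :=
  Lp ℂ 2 ((volume : Measure ℝ).restrict (Set.Ioo 0 ℓ))

/-- `g ∈ L²(0, ℓ)` is the weak derivative of `f ∈ L²(0, ℓ)`. -/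
def HasWeakDeriv {ℓ : ℝ} (f g : L2Edge ℓ) : Prop :=
  ∀ φ : ℝ → ℝ, ContDiff ℝ ∞ φ → HasCompactSupport φ → tsupport φ ⊆ Set.Ioo 0 ℓ →
    ∫ x in Set.Ioo 0 ℓ, deriv φ x • f x = -∫ x in Set.Ioo 0 ℓ, φ x • g x

/-- `u` is, on `[0, ℓ]`, the continuous extension of (a representative of) `f ∈ L²(0, ℓ)`. -/
def IsContExt {ℓ : ℝ} (f : L2Edge ℓ) (u : ℝ → ℂ) : Prop :=
  ContinuousOn u (Set.Icc 0 ℓ) ∧ f =ᵐ[volume.restrict (Set.Ioo 0 ℓ)] u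

theorem integrable_smul_L2Edge {ℓ : ℝ} (f : L2Edge ℓ) {φ : ℝ → ℝ} (hφ : Continuous φ)
    (hc : HasCompactSupport φ) :
    Integrable (fun x => φ x • f x) (volume.restrict (Set.Ioo 0 ℓ)) := by
  obtain ⟨C, hC⟩ := hc.exists_bound_of_continuous hφ
  have hf : Integrable (f : ℝ → ℂ) (volume.restrict (Set.Ioo 0 ℓ)) :=
    (Lp.memLp f).integrable (by norm_num)
  exact hf.bdd_smul C hφ.aestronglyMeasurable (Filter.Eventually.of_forall hC)

theorem HasWeakDeriv.add {ℓ : ℝ} {f g f' g' : L2Edge ℓ} (h : HasWeakDeriv f g)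
    (h' : HasWeakDeriv f' g') : HasWeakDeriv (f + f') (g + g') := by
  intro φ h1 h2 h3
  have a1 : ∫ x in Set.Ioo 0 ℓ, deriv φ x • (f + f' : L2Edge ℓ) x
      = ∫ x in Set.Ioo 0 ℓ, (deriv φ x • f x + deriv φ x • f' x) := by
    refine integral_congr_ae ?_
    filter_upwards [Lp.coeFn_add f f'] with x hx
    rw [hx, Pi.add_apply, smul_add]
  have a2 : ∫ x in Set.Ioo 0 ℓ, φ x • (g + g' : L2Edge ℓ) x
      = ∫ x in Set.Ioo 0 ℓ, (φ x • g x + φ x • g' x) := by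
    refine integral_congr_ae ?_
    filter_upwards [Lp.coeFn_add g g'] with x hx
    rw [hx, Pi.add_apply, smul_add]
  have hd : Continuous (deriv φ) := h1.continuous_deriv (by simp)
  rw [a1, a2, integral_add (integrable_smul_L2Edge f hd h2.deriv)
    (integrable_smul_L2Edge f' hd h2.deriv),
    integral_add (integrable_smul_L2Edge g h1.continuous h2)
    (integrable_smul_L2Edge g' h1.continuous h2), h φ h1 h2 h3, h' φ h1 h2 h3]
  ring

theorem HasWeakDeriv.smul {ℓ : ℝ} {f g : L2Edge ℓ} (c : ℂ) (h : HasWeakDeriv f g) :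
    HasWeakDeriv (c • f) (c • g) := by
  intro φ h1 h2 h3
  have a1 : ∫ x in Set.Ioo 0 ℓ, deriv φ x • (c • f : L2Edge ℓ) x
      = ∫ x in Set.Ioo 0 ℓ, c • (deriv φ x • f x) := by
    refine integral_congr_ae ?_
    filter_upwards [Lp.coeFn_smul c f] with x hx
    rw [hx, Pi.smul_apply, smul_comm]
  have a2 : ∫ x in Set.Ioo 0 ℓ, φ x • (c • g : L2Edge ℓ) x
      = ∫ x in Set.Ioo 0 ℓ, c • (φ x • g x) := by
    refine integral_congr_ae ?_
    filter_upwards [Lp.coeFn_smul c g] with x hx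
    rw [hx, Pi.smul_apply, smul_comm]
  rw [a1, a2, integral_smul, integral_smul, h φ h1 h2 h3, smul_neg]

theorem integral_smul_L2Edge_zero {ℓ : ℝ} (φ : ℝ → ℝ) :
    ∫ x in Set.Ioo 0 ℓ, φ x • (0 : L2Edge ℓ) x = 0 := by
  refine integral_eq_zero_of_ae ?_
  filter_upwards [Lp.coeFn_zero ℂ 2 ((volume : Measure ℝ).restrict (Set.Ioo 0 ℓ))] with x hx
  rw [hx]
  exact smul_zero (φ x)

theorem hasWeakDeriv_zero {ℓ : ℝ} : HasWeakDeriv (0 : L2Edge ℓ) 0 := by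
  intro φ _ _ _
  rw [integral_smul_L2Edge_zero, integral_smul_L2Edge_zero, neg_zero]

/-- The weak derivative is unique: the zero function has only the weak derivative zero. -/
theorem HasWeakDeriv.eq_zero {ℓ : ℝ} {g : L2Edge ℓ} (h : HasWeakDeriv 0 g) : g = 0 := by
  have hg : Integrable (g : ℝ → ℂ) (volume.restrict (Set.Ioo 0 ℓ)) :=
    (Lp.memLp g).integrable (by norm_num)
  have hloc : LocallyIntegrableOn (g : ℝ → ℂ) (Set.Ioo 0 ℓ) volume :=
    IntegrableOn.locallyIntegrableOn hg
  have key := isOpen_Ioo.ae_eq_zero_of_integral_contDiff_smul_eq_zero hloc (by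
    intro φ h1 h2 h3
    have e := h φ h1 h2 h3
    rw [integral_smul_L2Edge_zero] at e
    rw [← setIntegral_eq_integral_of_forall_compl_eq_zero (s := Set.Ioo 0 ℓ)]
    · exact neg_eq_zero.mp e.symm
    · intro x hx
      rw [image_eq_zero_of_notMem_tsupport (fun hh => hx (h3 hh)), zero_smul])
  refine Lp.ext ?_
  have k2 : ∀ᵐ x ∂(volume.restrict (Set.Ioo 0 ℓ)), g x = 0 :=
    (ae_restrict_iff' measurableSet_Ioo).mpr key
  filter_upwards [k2, Lp.coeFn_zero ℂ 2 ((volume : Measure ℝ).restrict (Set.Ioo 0 ℓ))] with x h1 h2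
  rw [h1, h2, Pi.zero_apply]

theorem IsContExt.add {ℓ : ℝ} {f f' : L2Edge ℓ} {u u' : ℝ → ℂ} (h : IsContExt f u)
    (h' : IsContExt f' u') : IsContExt (f + f') (u + u') :=
  ⟨h.1.add h'.1, (Lp.coeFn_add f f').trans (h.2.add h'.2)⟩

theorem IsContExt.smul {ℓ : ℝ} {f : L2Edge ℓ} {u : ℝ → ℂ} (c : ℂ) (h : IsContExt f u) :
    IsContExt (c • f) (c • u) :=
  ⟨h.1.const_smul c, (Lp.coeFn_smul c f).trans (h.2.const_smul c)⟩

theorem isContExt_zero {ℓ : ℝ} : IsContExt (0 : L2Edge ℓ) 0 :=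
  ⟨continuousOn_const, Lp.coeFn_zero ℂ 2 _⟩

variable {V E : Type*}

/-! ### The Laplacian with Kirchhoff vertex conditions -/

/-- The Hilbert space `L²(G)`, the orthogonal sum of the spaces `L²(0, L e)`. -/
abbrev L2 (G : MetricGraph V E) : Type _ := PiLp 2 fun e => L2Edge (G.L e)

/-- The values at the ends of the edges of the functions `u e`, given on `[0, L e]`, agree at each
vertex. -/
def ContinuousAtVertices (G : MetricGraph V E) (u : E → ℝ → ℂ) : Prop :=
  ∃ c : V → ℂ, ∀ e, u e 0 = c (G.o e) ∧ u e (G.L e) = c (G.t e)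

open scoped Classical in
/-- The sum at the vertex `v` of the derivatives pointing towards `v`, where `w e` is the derivative
on the edge `e`, continuously extended to `[0, L e]`. -/
def normalDeriv [Fintype E] (G : MetricGraph V E) (w : E → ℝ → ℂ) (v : V) : ℂ :=
  (∑ e with G.t e = v, w e (G.L e)) - (∑ e with G.o e = v, w e 0)

/-- `f` belongs to the domain of the Kirchhoff Laplacian `-Δ_G`, with first derivative `g`, continuous
extensions `u` of `f` and `w` of `g` to the closed edges, and `-Δ_G f = h`, that is, `f_e'' = -h_e`
on each edge `e`. -/
structure IsKirchhoff [Fintype E] (G : MetricGraph V E) (f h g : G.L2) (u w : E → ℝ → ℂ) :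
    Prop where
  deriv_fst : ∀ e, HasWeakDeriv (f e) (g e)
  deriv_snd : ∀ e, HasWeakDeriv (g e) (-(h e))
  contExt_fst : ∀ e, IsContExt (f e) (u e)
  contExt_snd : ∀ e, IsContExt (g e) (w e)
  continuous : G.ContinuousAtVertices u
  kirchhoff : ∀ v, G.normalDeriv w v = 0

/-- The graph `{(f, -Δ_G f)}` of the Kirchhoff Laplacian. -/
def laplacianGraph [Fintype E] (G : MetricGraph V E) : Submodule ℂ (G.L2 × G.L2) where
  carrier := {p | ∃ g u w, G.IsKirchhoff p.1 p.2 g u w}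
  zero_mem' := by
    refine ⟨0, 0, 0, ⟨fun e => hasWeakDeriv_zero, fun e => ?_, fun e => isContExt_zero,
      fun e => isContExt_zero, ⟨0, fun e => by simp⟩, fun v => by simp [normalDeriv]⟩⟩
    simpa using hasWeakDeriv_zero (ℓ := G.L e)
  add_mem' := by
    rintro ⟨f, h⟩ ⟨f', h'⟩ ⟨g, u, w, H⟩ ⟨g', u', w', H'⟩
    refine ⟨g + g', u + u', w + w', ⟨fun e => (H.deriv_fst e).add (H'.deriv_fst e), fun e => ?_,
      fun e => (H.contExt_fst e).add (H'.contExt_fst e),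
      fun e => (H.contExt_snd e).add (H'.contExt_snd e), ?_, fun v => ?_⟩⟩
    · have := (H.deriv_snd e).add (H'.deriv_snd e)
      rwa [← neg_add] at this
    · obtain ⟨c, hc⟩ := H.continuous
      obtain ⟨c', hc'⟩ := H'.continuous
      exact ⟨c + c', fun e => by simp [hc e, hc' e]⟩
    · have h1 := H.kirchhoff v
      have h2 := H'.kirchhoff v
      simp only [normalDeriv, Pi.add_apply, Finset.sum_add_distrib] at h1 h2 ⊢
      linear_combination h1 + h2
  smul_mem' := by
    rintro c ⟨f, h⟩ ⟨g, u, w, H⟩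
    refine ⟨c • g, c • u, c • w, ⟨fun e => (H.deriv_fst e).smul c, fun e => ?_,
      fun e => (H.contExt_fst e).smul c, fun e => (H.contExt_snd e).smul c, ?_, fun v => ?_⟩⟩
    · have := (H.deriv_snd e).smul c
      rwa [smul_neg] at this
    · obtain ⟨d, hd⟩ := H.continuous
      exact ⟨c • d, fun e => by simp [hd e]⟩
    · have h1 := H.kirchhoff v
      simp only [normalDeriv, Pi.smul_apply, smul_eq_mul, ← Finset.mul_sum] at h1 ⊢
      linear_combination c * h1

/-- `laplacianGraph` is the graph of an operator. -/
theorem laplacianGraph_single_valued [Fintype E] (G : MetricGraph V E) :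
    ∀ x ∈ G.laplacianGraph, x.1 = 0 → x.2 = 0 := by
  rintro ⟨f, h⟩ ⟨g, u, w, H⟩ hf
  change f = 0 at hf
  change h = 0
  subst hf
  have hg : g = 0 := PiLp.ext fun e => (H.deriv_fst e).eq_zero
  subst hg
  exact PiLp.ext fun e => neg_eq_zero.mp (H.deriv_snd e).eq_zero

/-- The Kirchhoff Laplacian `-Δ_G`, an unbounded operator in `L²(G)`. -/
def negLaplacian [Fintype E] (G : MetricGraph V E) : G.L2 →ₗ.[ℂ] G.L2 :=
  G.laplacianGraph.toLinearPMap

theorem negLaplacian_graph [Fintype E] (G : MetricGraph V E) :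
    G.negLaplacian.graph = G.laplacianGraph :=
  Submodule.toLinearPMap_graph_eq _ G.laplacianGraph_single_valued

/-- The eigenspace `ker (-Δ_G - lam)`. -/
def eigenspace [Fintype E] (G : MetricGraph V E) (lam : ℝ) : Submodule ℂ G.L2 where
  carrier := {f | ∃ hf : f ∈ G.negLaplacian.domain, G.negLaplacian ⟨f, hf⟩ = (lam : ℂ) • f}
  zero_mem' := ⟨zero_mem _, by
    rw [smul_zero]; exact LinearPMap.map_zero _⟩
  add_mem' := by
    rintro f g ⟨hf, ef⟩ ⟨hg, eg⟩
    refine ⟨add_mem hf hg, ?_⟩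
    rw [smul_add, ← ef, ← eg]
    exact LinearPMap.map_add _ ⟨f, hf⟩ ⟨g, hg⟩
  smul_mem' := by
    rintro c f ⟨hf, ef⟩
    refine ⟨Submodule.smul_mem _ c hf, ?_⟩
    rw [smul_comm, ← ef]
    exact LinearPMap.map_smul _ c ⟨f, hf⟩

/-- The functions that are continuous up to the ends of each edge and vanish at each vertex. -/
def vanishing (G : MetricGraph V E) : Submodule ℂ G.L2 where
  carrier := {f | ∃ u : E → ℝ → ℂ, (∀ e, IsContExt (f e) (u e)) ∧
    ∀ e, u e 0 = 0 ∧ u e (G.L e) = 0}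
  zero_mem' := ⟨0, fun _ => isContExt_zero, fun _ => ⟨rfl, rfl⟩⟩
  add_mem' := by
    rintro f g ⟨u, hu, zu⟩ ⟨w, hw, zw⟩
    exact ⟨u + w, fun e => (hu e).add (hw e), fun e => by simp [zu e, zw e]⟩
  smul_mem' := by
    rintro c f ⟨u, hu, zu⟩
    exact ⟨c • u, fun e => (hu e).smul c, fun e => by simp [zu e]⟩

/-- The resonance eigenspace `R(G, lam)`: the functions in `ker (-Δ_G - lam)` that vanish at each
vertex. -/
def resonanceSpace [Fintype E] (G : MetricGraph V E) (lam : ℝ) : Submodule ℂ G.L2 :=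
  G.eigenspace lam ⊓ G.vanishing

/-- `lam` is a real resonance of `G`. -/
def IsResonance [Fintype E] (G : MetricGraph V E) (lam : ℝ) : Prop :=
  ∃ f ∈ G.resonanceSpace lam, f ≠ 0

/-! ### Components, the first Betti number and cycles -/

/-- The edge `e` joins the vertices `v` and `w`, in one of the two directions. -/
def Joins (G : MetricGraph V E) (e : E) (v w : V) : Prop :=
  (G.o e = v ∧ G.t e = w) ∨ (G.o e = w ∧ G.t e = v)

/-- The simple graph of adjacent distinct vertices. It has the connected components of `G`. -/
def toSimpleGraph (G : MetricGraph V E) : SimpleGraph V :=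
  SimpleGraph.fromRel fun v w => ∃ e, G.Joins e v w

/-- The number `β₀` of connected components. -/
def betti0 (G : MetricGraph V E) : ℕ := Nat.card G.toSimpleGraph.ConnectedComponent

/-- The first Betti number `β₁ = |E| - |V| + β₀`. -/
def betti1 (G : MetricGraph V E) : ℤ := Nat.card E - Nat.card V + G.betti0

/-- A cycle with `n + 1` distinct vertices and `n + 1` distinct edges; the edge number `i` joins
vertex number `i` to vertex number `i + 1`, taken modulo `n + 1`. A loop is a cycle with `n = 0`, two
parallel edges form a cycle with `n = 1`. -/
structure Cycle (G : MetricGraph V E) where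
  n : ℕ
  vert : Fin (n + 1) → V
  edge : Fin (n + 1) → E
  vert_injective : Function.Injective vert
  edge_injective : Function.Injective edge
  joins : ∀ i, G.Joins (edge i) (vert i) (vert (i + 1))

/-- The length of a cycle. -/
def Cycle.length {G : MetricGraph V E} (C : G.Cycle) : ℝ := ∑ i, G.L (C.edge i)

/-- The length of the cycle is an odd multiple of `x`. -/
def Cycle.HasOddLength {G : MetricGraph V E} (C : G.Cycle) (x : ℝ) : Prop :=
  ∃ k : ℕ, Odd k ∧ C.length = k * x

/-- The number of connected components which contain a cycle with odd length with respect
to `x`. -/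
def betti0Odd (G : MetricGraph V E) (x : ℝ) : ℕ :=
  Nat.card {c : G.toSimpleGraph.ConnectedComponent //
    ∃ C : G.Cycle, C.HasOddLength x ∧ ∀ i, G.toSimpleGraph.connectedComponentMk (C.vert i) = c}

/-- The subgraph consisting of the edges whose lengths are natural multiples of `x`, and of their
endpoints. -/
def multipleSubgraph (G : MetricGraph V E) (x : ℝ) :
    MetricGraph {v : V // ∃ e, (∃ k : ℕ, G.L e = k * x) ∧ (G.o e = v ∨ G.t e = v)}
      {e : E // ∃ k : ℕ, G.L e = k * x} where
  o e := ⟨G.o e.1, e.1, e.2, Or.inl rfl⟩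
  t e := ⟨G.t e.1, e.1, e.2, Or.inr rfl⟩
  L e := G.L e.1
  L_pos e := G.L_pos e.1

end MetricGraph

end

/-! Put κ = √λ. On an edge, a function in R(G, λ) solves f'' = -κ² f and vanishes at 0, so it is a_e
sin(κx). Vanishing at the other end forces a_e = 0 unless κ L(e) = k_e π, so only edges of G_λ carry
an amplitude. Continuity at the vertices is then automatic, and the Kirchhoff condition at v becomes
∑_{t(e)=v} (-1)^{k_e} a_e = ∑_{o(e)=v} a_e. Hence R(G, λ) is isomorphic to the kernel of the
incidence matrix of G_λ with signs s_e = (-1)^{k_e} at the terminal vertices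
(`resonanceSpace_eq_map`). Since the domain is defined by weak derivatives, du Bois-Reymond's lemma
is needed to reach the classical equation (`HasWeakDeriv.hasDerivWithinAt`).

The nullity follows from that of the transpose, whose kernel consists of the vertex functions φ with
φ(o e) = s_e φ(t e). Such a φ is transported along walks, up to the product of the signs. On a
component with a closed walk of sign -1 it must vanish; on any other component one value is free and
determines the rest (`finrank_ker_signedIncidence_transpose`). As row rank equals column rank, the
kernel of the matrix has dimension β₁ minus the number of components of the first kind
(`finrank_ker_signedIncidence`).

Finally, a shortest closed walk of sign -1 in a component is a cycle (`exists_cycle_of_walk`), and a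
cycle has sign -1 exactly if its length is an odd multiple of π/κ (`Cycle.hasOddLength_iff`). -/

theorem Relation.ReflTransGen.exists_walk {α : Type*} {r : α → α → Prop} {a b : α}
    (h : Relation.ReflTransGen r a b) :
    ∃ (n : ℕ) (f : ℕ → α), f 0 = a ∧ f n = b ∧ ∀ i < n, r (f i) (f (i + 1)) := by
  induction h with
  | refl => exact ⟨0, fun _ => a, rfl, rfl, fun i hi => absurd hi (Nat.not_lt_zero i)⟩
  | @tail b c _ hbc ih =>
    obtain ⟨n, f, h0, hn, hf⟩ := ih
    refine ⟨n + 1, fun i => if i ≤ n then f i else c, by simpa using h0, by simp, fun i hi => ?_⟩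
    rcases Nat.lt_succ_iff_lt_or_eq.mp hi with h | rfl
    · have h1 : i ≤ n := h.le
      have h2 : i + 1 ≤ n := h
      simpa [h1, h2] using hf i h
    · simpa [hn] using hbc

/-! ### Signed walks, the double cover, and cycles of sign -1. -/

namespace MetricGraph

variable {V E : Type*}

theorem Joins.symm {H : MetricGraph V E} {e : E} {v w : V} (h : H.Joins e v w) :
    H.Joins e w v := Or.symm h

theorem Joins.unordered_eq {H : MetricGraph V E} {e : E} {v w v' w' : V} (h : H.Joins e v w)
    (h' : H.Joins e v' w') : (v = v' ∧ w = w') ∨ (v = w' ∧ w = v') := by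
  rcases h with ⟨rfl, rfl⟩ | ⟨rfl, rfl⟩ <;> rcases h' with ⟨rfl, rfl⟩ | ⟨rfl, rfl⟩ <;> simp

theorem Joins.connectedComponentMk_eq {H : MetricGraph V E} {e : E} {v w : V}
    (h : H.Joins e v w) :
    H.toSimpleGraph.connectedComponentMk v = H.toSimpleGraph.connectedComponentMk w := by
  by_cases hvw : v = w
  · rw [hvw]
  · refine SimpleGraph.ConnectedComponent.sound (SimpleGraph.Adj.reachable ?_)
    rw [toSimpleGraph, SimpleGraph.fromRel_adj]
    exact ⟨hvw, Or.inl ⟨e, h⟩⟩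

/-- One step in the double cover of `H` defined by the signs `s` of the edges. -/
def SignedStep (H : MetricGraph V E) (s : E → ℤˣ) (a b : V × ℤˣ) : Prop :=
  ∃ e, H.Joins e a.1 b.1 ∧ b.2 = s e * a.2

/-- The points `a` and `b` belong to the same component of the double cover of `H`. -/
def SignedReachable (H : MetricGraph V E) (s : E → ℤˣ) : V × ℤˣ → V × ℤˣ → Prop :=
  Relation.ReflTransGen (H.SignedStep s)

/-- The component `c` contains a closed walk with sign `-1`. -/
def Unbalanced (H : MetricGraph V E) (s : E → ℤˣ) (c : H.toSimpleGraph.ConnectedComponent) :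
    Prop :=
  ∃ v, H.toSimpleGraph.connectedComponentMk v = c ∧ H.SignedReachable s (v, 1) (v, -1)

variable {H : MetricGraph V E} {s : E → ℤˣ}

theorem SignedStep.symm {a b : V × ℤˣ} (h : H.SignedStep s a b) : H.SignedStep s b a := by
  obtain ⟨e, he, h⟩ := h
  exact ⟨e, he.symm, by rw [h, ← mul_assoc, Int.units_mul_self, one_mul]⟩

theorem SignedReachable.symm {a b : V × ℤˣ} (h : H.SignedReachable s a b) :
    H.SignedReachable s b a :=
  have : Std.Symm (H.SignedStep s) := ⟨fun _ _ => SignedStep.symm⟩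
  Relation.ReflTransGen.stdSymm.symm _ _ h

/-- Multiplying the sign coordinate by r is a deck transformation of the double cover: it maps steps
to steps. -/
theorem SignedReachable.mul {v w : V} {p q : ℤˣ} (h : H.SignedReachable s (v, p) (w, q))
    (r : ℤˣ) : H.SignedReachable s (v, p * r) (w, q * r) := by
  refine Relation.ReflTransGen.lift (fun a : V × ℤˣ => (a.1, a.2 * r)) ?_ _ _ h
  rintro a b ⟨e, he, hb⟩
  exact ⟨e, he, by simp only [hb, mul_assoc]⟩

theorem SignedReachable.connectedComponentMk_eq {a b : V × ℤˣ} (h : H.SignedReachable s a b) :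
    H.toSimpleGraph.connectedComponentMk a.1 = H.toSimpleGraph.connectedComponentMk b.1 := by
  induction h with
  | refl => rfl
  | tail _ h ih =>
    obtain ⟨e, he, -⟩ := h
    exact ih.trans he.connectedComponentMk_eq

/-- Paths lift to the double cover; the sheet where the lift ends depends on the path. -/
theorem exists_signedReachable (s : E → ℤˣ) {v w : V} (h : H.toSimpleGraph.Reachable v w) :
    ∃ p, H.SignedReachable s (v, 1) (w, p) := by
  rw [SimpleGraph.reachable_iff_reflTransGen] at h
  induction h with
  | refl => exact ⟨1, Relation.ReflTransGen.refl⟩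
  | tail _ hadj ih =>
    obtain ⟨p, hp⟩ := ih
    rw [toSimpleGraph, SimpleGraph.fromRel_adj] at hadj
    rcases hadj.2 with ⟨e, he⟩ | ⟨e, he⟩
    · exact ⟨s e * p, hp.tail ⟨e, he, rfl⟩⟩
    · exact ⟨s e * p, hp.tail ⟨e, he.symm, rfl⟩⟩

/-- In an unbalanced component, every vertex lies on a closed walk with sign `-1`. -/
theorem Unbalanced.signedReachable_neg {v : V}
    (h : H.Unbalanced s (H.toSimpleGraph.connectedComponentMk v)) :
    H.SignedReachable s (v, 1) (v, -1) := by
  obtain ⟨w, hw, h⟩ := h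
  obtain ⟨p, hp⟩ := exists_signedReachable s (SimpleGraph.ConnectedComponent.exact hw.symm)
  -- Walk from v to w, once round the closed walk at w, and back the same way: the sign p occurs
  -- twice and cancels.
  have h1 : H.SignedReachable s (v, 1) (w, -p) := hp.trans (by simpa using! h.mul p)
  have h2 : H.SignedReachable s (w, -p) (v, -1) := by simpa using (hp.mul (-1)).symm
  exact h1.trans h2

/-- A closed walk with sign `-1`, chosen with the least number of steps, is a cycle. -/
theorem exists_cycle_of_walk {n : ℕ} {f : ℕ → V × ℤˣ} (h1 : (f n).1 = (f 0).1)
    (h2 : (f n).2 = -(f 0).2) (hf : ∀ i < n, H.SignedStep s (f i) (f (i + 1)))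
    (hmin : ∀ m < n, ∀ g : ℕ → V × ℤˣ, (g m).1 = (g 0).1 → (g m).2 = -(g 0).2 →
      H.toSimpleGraph.connectedComponentMk (g 0).1 =
        H.toSimpleGraph.connectedComponentMk (f 0).1 →
      ∃ i < m, ¬ H.SignedStep s (g i) (g (i + 1))) :
    ∃ C : H.Cycle, C.vert 0 = (f 0).1 ∧ ∏ i, s (C.edge i) = -1 := by
  obtain _ | m := n
  · exact absurd h2 (units_ne_neg_self _)
  have hcomp : ∀ i ≤ m + 1, H.toSimpleGraph.connectedComponentMk (f i).1 =
      H.toSimpleGraph.connectedComponentMk (f 0).1 := by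
    intro i
    induction i with
    | zero => exact fun _ => rfl
    | succ i ih =>
      intro hi
      obtain ⟨e, he, -⟩ := hf i hi
      exact he.connectedComponentMk_eq.symm.trans (ih (by omega))
  have hinj : ∀ i j, i < j → j ≤ m → (f i).1 ≠ (f j).1 := by
    intro i j hij hj heq
    -- A repeated vertex splits the walk into two closed walks whose signs multiply to -1. If the
    -- part from i to j has sign 1, cutting it out leaves a shorter walk of sign -1; otherwise that
    -- part is itself one.
    by_cases hs : (f j).2 = (f i).2
    · obtain ⟨l, hl, hl'⟩ := hmin (m + 1 - (j - i)) (by omega)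
        (fun l => if l ≤ i then f l else f (l + (j - i)))
        (by
          have : ¬ (m + 1 - (j - i) ≤ i) := by omega
          have h3 : m + 1 - (j - i) + (j - i) = m + 1 := by omega
          simpa [this, h3] using h1)
        (by
          have : ¬ (m + 1 - (j - i) ≤ i) := by omega
          have h3 : m + 1 - (j - i) + (j - i) = m + 1 := by omega
          simpa [this, h3] using h2)
        (by simp)
      apply hl'
      rcases lt_trichotomy l i with h | rfl | h
      · have : l + 1 ≤ i := h
        simpa [h.le, this] using hf l (by omega)
      · have h3 : l + 1 + (j - l) = j + 1 := by omega
        have h4 : f l = f j := Prod.ext heq hs.symm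
        simpa [h3, h4] using hf j (by omega)
      · have h3 : ¬ l ≤ i := by omega
        have h4 : ¬ l + 1 ≤ i := by omega
        have h5 : l + 1 + (j - i) = l + (j - i) + 1 := by omega
        simpa [h3, h4, h5] using hf (l + (j - i)) (by omega)
    · obtain ⟨l, hl, hl'⟩ := hmin (j - i) (by omega) (fun l => f (i + l))
        (by simp [show i + (j - i) = j by omega, heq])
        (by
          simp only [show i + (j - i) = j by omega, add_zero]
          exact Int.units_ne_iff_eq_neg.mp hs)
        (hcomp i (by omega))
      exact hl' (hf (i + l) (by omega))
  have hvert : ∀ i j, i ≤ m → j ≤ m → (f i).1 = (f j).1 → i = j := by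
    intro i j hi hj h
    rcases lt_trichotomy i j with h' | h' | h'
    · exact absurd h (hinj i j h' hj)
    · exact h'
    · exact absurd h.symm (hinj j i h' hi)
  have : Nonempty E := ⟨(hf 0 m.succ_pos).choose⟩
  choose! e he hs using hf
  have hprod : ∀ j ≤ m + 1, (f j).2 = (∏ i ∈ Finset.range j, s (e i)) * (f 0).2 := by
    intro j
    induction j with
    | zero => simp
    | succ j ih =>
      intro hj
      rw [hs j (by omega), ih (by omega), Finset.prod_range_succ, ← mul_assoc, mul_comm (s (e j))]
  have htotal : ∏ i ∈ Finset.range (m + 1), s (e i) = -1 := by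
    have h3 := (hprod (m + 1) le_rfl).symm.trans h2
    exact mul_right_cancel (h3.trans (neg_one_mul _).symm)
  -- In `Fin (m + 1)` the successor of m is 0. This is harmless for the vertices, because the walk
  -- is closed, but not for the signs.
  have hsucc : ∀ i : Fin (m + 1), (f ((i + 1 : Fin (m + 1)) : ℕ)).1 = (f ((i : ℕ) + 1)).1 := by
    intro i
    rw [Fin.val_add_one]
    split_ifs with hi
    · simp [hi, h1]
    · rfl
  have hjoins : ∀ i : Fin (m + 1),
      H.Joins (e i) (f (i : ℕ)).1 (f ((i + 1 : Fin (m + 1)) : ℕ)).1 := by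
    intro i
    rw [hsucc]
    exact he i i.2
  have hvinj : Function.Injective fun i : Fin (m + 1) => (f (i : ℕ)).1 := fun i j h =>
    Fin.ext (hvert i j (by omega) (by omega) h)
  refine ⟨⟨m, fun i => (f i).1, fun i => e i, hvinj, fun i j hij => ?_, hjoins⟩, by simp, ?_⟩
  · have hi := hjoins i
    rw [show e i = e j from hij] at hi
    -- An edge used at two distinct positions must be traversed in opposite directions, as the
    -- vertices are distinct. Then i and j are cyclic successors of each other, so the walk has two
    -- steps along the same edge, and its sign is a square, not -1.
    rcases hi.unordered_eq (hjoins j) with ⟨h, -⟩ | ⟨h, h'⟩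
    · exact hvinj h
    · have h3 : i = j + 1 := hvinj h
      have h4 : i + 1 = j := hvinj h'
      by_contra hne
      have hm : m = 1 := by
        have h5 := congrArg Fin.val h3
        have h6 := congrArg Fin.val h4
        rw [Fin.val_add_one] at h5 h6
        have h7 : (i : ℕ) ≠ j := fun h => hne (Fin.ext h)
        split_ifs at h5 h6 with h8 h9 h9
        · simp_all
        · have := congrArg Fin.val h8
          simp at this
          omega
        · have := congrArg Fin.val h9
          simp at this
          omega
        · omega
      subst hm
      have h01 : e 0 = e 1 := by
        have hij' : e i = e j := hij
        have h7 : (i : ℕ) ≠ j := fun h => hne (Fin.ext h)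
        have h8 : ((i : ℕ) = 0 ∧ (j : ℕ) = 1) ∨ ((i : ℕ) = 1 ∧ (j : ℕ) = 0) := by omega
        rcases h8 with ⟨h8, h9⟩ | ⟨h8, h9⟩
        · rwa [h8, h9] at hij'
        · rw [h8, h9] at hij'
          exact hij'.symm
      rw [Finset.prod_range_succ, Finset.prod_range_one, h01, Int.units_mul_self] at htotal
      exact absurd htotal (by decide)
  · exact (Fin.prod_univ_eq_prod_range (fun i => s (e i)) (m + 1)).trans htotal

theorem Cycle.connectedComponentMk_vert (C : H.Cycle) (i : Fin (C.n + 1)) :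
    H.toSimpleGraph.connectedComponentMk (C.vert i) =
      H.toSimpleGraph.connectedComponentMk (C.vert 0) := by
  induction i using Fin.induction with
  | zero => rfl
  | succ i ih =>
    rw [← ih, ← (C.joins i.castSucc).connectedComponentMk_eq.symm, Fin.coeSucc_eq_succ]

/-- Going once round the cycle collects the signs of all its edges. The induction runs over natural
numbers, reduced modulo n + 1 to indices of the cycle, so that the last step returns to vertex 0. -/
theorem Cycle.signedReachable (C : H.Cycle) (s : E → ℤˣ) :
    H.SignedReachable s (C.vert 0, 1) (C.vert 0, ∏ i, s (C.edge i)) := by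
  have key : ∀ j : ℕ, H.SignedReachable s (C.vert 0, 1)
      (C.vert (Fin.ofNat (C.n + 1) j),
        ∏ i ∈ Finset.range j, s (C.edge (Fin.ofNat (C.n + 1) i))) := by
    intro j
    induction j with
    | zero => exact Relation.ReflTransGen.refl
    | succ j ih =>
      refine ih.tail ⟨C.edge (Fin.ofNat (C.n + 1) j), ?_, ?_⟩
      · have h : Fin.ofNat (C.n + 1) (j + 1) = Fin.ofNat (C.n + 1) j + 1 := by
          ext
          simp [Fin.val_add]
        rw [h]
        exact C.joins _
      · rw [Finset.prod_range_succ, mul_comm]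
  have h := key (C.n + 1)
  rw [← Fin.prod_univ_eq_prod_range (fun i : ℕ => s (C.edge (Fin.ofNat (C.n + 1) i)))] at h
  have h0 : Fin.ofNat (C.n + 1) (C.n + 1) = 0 := by
    ext
    simp
  have h1 : ∀ i : Fin (C.n + 1), Fin.ofNat (C.n + 1) i = i := fun i =>
    Fin.ext (Nat.mod_eq_of_lt i.2)
  simpa only [h0, h1] using h

/-- A shortest closed walk of sign -1 is a cycle; conversely, a cycle is a closed walk. -/
theorem unbalanced_iff_exists_cycle {c : H.toSimpleGraph.ConnectedComponent} :
    H.Unbalanced s c ↔ ∃ C : H.Cycle, ∏ i, s (C.edge i) = -1 ∧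
      ∀ i, H.toSimpleGraph.connectedComponentMk (C.vert i) = c := by
  constructor
  · rintro ⟨v, hv, h⟩
    classical
    -- The minimum is taken over all starting points in the component, since a closed part cut from
    -- a walk may start elsewhere than the walk.
    have hex : ∃ n, ∃ f : ℕ → V × ℤˣ, (f n).1 = (f 0).1 ∧ (f n).2 = -(f 0).2 ∧
        (∀ i < n, H.SignedStep s (f i) (f (i + 1))) ∧
        H.toSimpleGraph.connectedComponentMk (f 0).1 = c := by
      obtain ⟨n, f, h0, hn, hf⟩ := h.exists_walk
      exact ⟨n, f, by rw [h0, hn], by rw [h0, hn], hf, by rw [h0, hv]⟩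
    obtain ⟨f, h1, h2, hf, hc⟩ := Nat.find_spec hex
    obtain ⟨C, hC, hs⟩ := exists_cycle_of_walk h1 h2 hf (by
      intro m hm g hg1 hg2 hg3
      by_contra! hg
      exact Nat.find_min hex hm ⟨g, hg1, hg2, hg, hg3.trans hc⟩)
    exact ⟨C, hs, fun i => by rw [C.connectedComponentMk_vert, hC, hc]⟩
  · rintro ⟨C, hC, hc⟩
    exact ⟨C.vert 0, hc 0, hC ▸ C.signedReachable s⟩

end MetricGraph

/-! ### The signed incidence matrix and its nullity. -/

namespace MetricGraph

variable {V E : Type*}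

open scoped Classical in
/-- The incidence matrix of `H` with the signs `s` at the terminal vertices of the edges. -/
noncomputable def signedIncidence (H : MetricGraph V E) (s : E → ℤˣ) : Matrix V E ℂ :=
  Matrix.of fun v e => (if H.t e = v then ((s e : ℤ) : ℂ) else 0) - if H.o e = v then 1 else 0

open scoped Classical in
theorem signedIncidence_mulVec [Fintype E] (H : MetricGraph V E) (s : E → ℤˣ) (a : E → ℂ)
    (v : V) : (H.signedIncidence s).mulVec a v =
      (∑ e with H.t e = v, ((s e : ℤ) : ℂ) * a e) - ∑ e with H.o e = v, a e := by
  simp only [Matrix.mulVec, dotProduct, signedIncidence, Matrix.of_apply, sub_mul, ite_mul,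
    zero_mul, one_mul, Finset.sum_sub_distrib, Finset.sum_filter]

theorem signedIncidence_transpose_mulVec [Fintype V] (H : MetricGraph V E) (s : E → ℤˣ)
    (φ : V → ℂ) (e : E) : (H.signedIncidence s).transpose.mulVec φ e =
      ((s e : ℤ) : ℂ) * φ (H.t e) - φ (H.o e) := by
  classical
  simp [Matrix.mulVec, dotProduct, signedIncidence, sub_mul, Finset.sum_sub_distrib]

theorem mem_ker_signedIncidence_transpose [Fintype V] {H : MetricGraph V E} {s : E → ℤˣ}
    {φ : V → ℂ} : φ ∈ LinearMap.ker (H.signedIncidence s).transpose.mulVecLin ↔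
      ∀ e, ((s e : ℤ) : ℂ) * φ (H.t e) = φ (H.o e) := by
  rw [LinearMap.mem_ker, Matrix.mulVecLin_apply, funext_iff]
  simp only [signedIncidence_transpose_mulVec, Pi.zero_apply, sub_eq_zero]

/-- A solution φ lifts to the function (v, p) ↦ p φ(v) on the double cover, which is constant along
steps because s_e² = 1. -/
theorem SignedReachable.mul_eq_mul {H : MetricGraph V E} {s : E → ℤˣ} {φ : V → ℂ}
    (hφ : ∀ e, ((s e : ℤ) : ℂ) * φ (H.t e) = φ (H.o e)) {a b : V × ℤˣ}
    (h : H.SignedReachable s a b) : ((a.2 : ℤ) : ℂ) * φ a.1 = ((b.2 : ℤ) : ℂ) * φ b.1 := by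
  induction h with
  | refl => rfl
  | @tail b c _ h ih =>
    obtain ⟨e, he, hs⟩ := h
    have h2 : ((s e : ℤ) : ℂ) * ((s e : ℤ) : ℂ) = 1 := by
      rw [← Int.cast_mul, ← Units.val_mul, Int.units_mul_self]
      simp
    have h3 := hφ e
    rw [ih, hs, Units.val_mul, Int.cast_mul]
    rcases he with ⟨h4, h5⟩ | ⟨h4, h5⟩
    · rw [h4, h5] at h3
      linear_combination (-((b.2 : ℤ) : ℂ)) * h3
    · rw [h4, h5] at h3
      linear_combination (-((b.2 : ℤ) : ℂ)) * φ b.1 * h2 + ((b.2 : ℤ) : ℂ) * ((s e : ℤ) : ℂ) * h3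

/-- The functions on the vertices with `φ (o e) = s e * φ (t e)` for all edges `e` are determined by
one value on each balanced component, which is arbitrary. -/
theorem finrank_ker_signedIncidence_transpose [Fintype V] (H : MetricGraph V E) (s : E → ℤˣ) :
    Module.finrank ℂ (LinearMap.ker (H.signedIncidence s).transpose.mulVecLin) =
      Nat.card {c // ¬ H.Unbalanced s c} := by
  classical
  have hroot : ∀ c : H.toSimpleGraph.ConnectedComponent,
      ∃ v, H.toSimpleGraph.connectedComponentMk v = c := fun c => c.exists_rep
  choose root hroot using hroot
  let F : LinearMap.ker (H.signedIncidence s).transpose.mulVecLin →ₗ[ℂ]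
      ({c // ¬ H.Unbalanced s c} → ℂ) :=
    LinearMap.pi fun c => (LinearMap.proj (root c.1)).comp (Submodule.subtype _)
  have hF : ∀ φ c, F φ c = φ.1 (root c.1) := fun _ _ => rfl
  have hinj : Function.Injective F := by
    rw [← LinearMap.ker_eq_bot, LinearMap.ker_eq_bot']
    rintro ⟨φ, hφ⟩ h0
    rw [mem_ker_signedIncidence_transpose] at hφ
    refine Subtype.ext (funext fun v => ?_)
    change φ v = 0
    by_cases hb : H.Unbalanced s (H.toSimpleGraph.connectedComponentMk v)
    · have h1 := hb.signedReachable_neg.mul_eq_mul hφ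
      simp at h1
      exact self_eq_neg.mp h1
    · have h1 : φ (root (H.toSimpleGraph.connectedComponentMk v)) = 0 := congrFun h0 ⟨_, hb⟩
      obtain ⟨p, hp⟩ := exists_signedReachable s (SimpleGraph.ConnectedComponent.exact
        (hroot (H.toSimpleGraph.connectedComponentMk v)))
      have h2 := hp.mul_eq_mul hφ
      simp only [h1, mul_zero] at h2
      rcases Int.units_eq_one_or p with rfl | rfl
      · simpa using h2.symm
      · simpa using h2.symm
  have hsurj : Function.Surjective F := by
    intro g
    -- The value 0 on unbalanced components is forced, since every solution vanishes there.
    let G : H.toSimpleGraph.ConnectedComponent → ℂ := fun c =>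
      if h : ¬ H.Unbalanced s c then g ⟨c, h⟩ else 0
    -- The sign of φ at v tells which point above v lies in the component of (root, 1) in the double
    -- cover.
    let φ : V → ℂ := fun v =>
      if H.SignedReachable s (root (H.toSimpleGraph.connectedComponentMk v), 1) (v, 1) then
        G (H.toSimpleGraph.connectedComponentMk v)
      else -G (H.toSimpleGraph.connectedComponentMk v)
    have hφ : ∀ e, ((s e : ℤ) : ℂ) * φ (H.t e) = φ (H.o e) := by
      intro e
      have hj : H.Joins e (H.o e) (H.t e) := Or.inl ⟨rfl, rfl⟩
      have hc := hj.connectedComponentMk_eq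
      simp only [φ, ← hc]
      set c := H.toSimpleGraph.connectedComponentMk (H.o e) with hcdef
      by_cases hb : H.Unbalanced s c
      · simp [G, hb]
      have hstep : ∀ p, H.SignedReachable s (root c, 1) (H.o e, p) ↔
          H.SignedReachable s (root c, 1) (H.t e, s e * p) := fun p =>
        ⟨fun h => h.tail ⟨e, hj, rfl⟩, fun h => h.tail ⟨e, hj.symm, by
          simp [← mul_assoc, Int.units_mul_self]⟩⟩
      -- Exactly one of the two points above t e is reached: not both by balance, at least one by
      -- connectedness.
      have hneg : H.SignedReachable s (root c, 1) (H.t e, -1) ↔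
          ¬ H.SignedReachable s (root c, 1) (H.t e, 1) := by
        constructor
        · intro h h'
          exact hb ⟨H.t e, hc.symm, h'.symm.trans h⟩
        · intro h
          obtain ⟨p, hp⟩ := exists_signedReachable s
            (SimpleGraph.ConnectedComponent.exact ((hroot c).trans hc))
          rcases Int.units_eq_one_or p with rfl | rfl
          · exact absurd hp h
          · exact hp
      rw [hstep 1, mul_one]
      rcases Int.units_eq_one_or (s e) with h | h
      · simp [h]
      · rw [h, hneg]
        by_cases h' : H.SignedReachable s (root c, 1) (H.t e, 1) <;> simp [h']
    refine ⟨⟨φ, mem_ker_signedIncidence_transpose.mpr hφ⟩, funext fun c => ?_⟩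
    rw [hF]
    have h1 : H.SignedReachable s (root c.1, 1) (root c.1, 1) := Relation.ReflTransGen.refl
    simp [φ, hroot, G, c.2, h1]
  rw [(LinearEquiv.ofBijective F ⟨hinj, hsurj⟩).finrank_eq, Module.finrank_fintype_fun_eq_card,
    Nat.card_eq_fintype_card]

/-- With r the common rank of the matrix and its transpose, the nullity is |E| - r, while |V| - r is
the number of balanced components, that is, β₀ minus the number of unbalanced ones. Eliminating r
gives the formula. -/
theorem finrank_ker_signedIncidence [Finite V] [Fintype E] (H : MetricGraph V E) (s : E → ℤˣ) :
    (Module.finrank ℂ (LinearMap.ker (H.signedIncidence s).mulVecLin) : ℤ) =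
      H.betti1 - Nat.card {c // H.Unbalanced s c} := by
  classical
  have := Fintype.ofFinite V
  have h1 := LinearMap.finrank_range_add_finrank_ker (H.signedIncidence s).mulVecLin
  have h2 := LinearMap.finrank_range_add_finrank_ker (H.signedIncidence s).transpose.mulVecLin
  have h3 : Module.finrank ℂ (LinearMap.range (H.signedIncidence s).transpose.mulVecLin) =
      Module.finrank ℂ (LinearMap.range (H.signedIncidence s).mulVecLin) :=
    Matrix.rank_transpose _
  rw [finrank_ker_signedIncidence_transpose, h3, Module.finrank_fintype_fun_eq_card,
    ← Nat.card_eq_fintype_card] at h2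
  rw [Module.finrank_fintype_fun_eq_card, ← Nat.card_eq_fintype_card] at h1
  have h4 : Nat.card {c // H.Unbalanced s c} + Nat.card {c // ¬ H.Unbalanced s c} = H.betti0 := by
    rw [betti0, Nat.card_eq_fintype_card, Nat.card_eq_fintype_card, Nat.card_eq_fintype_card,
      Fintype.card_subtype_compl]
    have := Fintype.card_subtype_le (H.Unbalanced s)
    omega
  rw [betti1]
  omega

/-- The length is (∑ k) x and the sign is (-1)^(∑ k). As x ≠ 0, the multiple is determined by the
length, so its parity is well defined. -/
theorem Cycle.hasOddLength_iff {H : MetricGraph V E} {x : ℝ} (hx : x ≠ 0) {k : E → ℕ}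
    (hk : ∀ e, H.L e = k e * x) (C : H.Cycle) :
    C.HasOddLength x ↔ ∏ i, (-1 : ℤˣ) ^ k (C.edge i) = -1 := by
  have hl : C.length = ((∑ i, k (C.edge i) : ℕ) : ℝ) * x := by
    simp only [Cycle.length, hk, Nat.cast_sum, Finset.sum_mul]
  rw [Finset.prod_pow_eq_pow_sum, HasOddLength, hl]
  constructor
  · rintro ⟨n, hn, h⟩
    rw [Nat.cast_injective (mul_right_cancel₀ hx h)]
    exact hn.neg_one_pow
  · intro h
    refine ⟨_, ?_, rfl⟩
    by_contra hodd
    rw [Nat.not_odd_iff_even] at hodd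
    rw [hodd.neg_one_pow] at h
    exact absurd h (by decide)

theorem finrank_ker_signedIncidence_neg_one_pow [Finite V] [Fintype E] (H : MetricGraph V E)
    {x : ℝ} (hx : x ≠ 0) {k : E → ℕ} (hk : ∀ e, H.L e = k e * x) :
    (Module.finrank ℂ
      (LinearMap.ker (H.signedIncidence fun e => (-1) ^ k e).mulVecLin) : ℤ) =
      H.betti1 - H.betti0Odd x := by
  rw [finrank_ker_signedIncidence, betti0Odd]
  simp only [unbalanced_iff_exists_cycle, Cycle.hasOddLength_iff hx hk]

end MetricGraph

/-! ### Test functions and du Bois-Reymond's lemma. -/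

/-- A primitive of a test function on an open interval with integral zero is a test function. -/
theorem exists_contDiff_deriv_eq_of_integral_eq_zero {ℓ : ℝ} {ψ : ℝ → ℝ} (h1 : ContDiff ℝ ∞ ψ)
    (h2 : HasCompactSupport ψ) (h3 : tsupport ψ ⊆ Set.Ioo 0 ℓ)
    (h0 : ∫ x in (0 : ℝ)..ℓ, ψ x = 0) :
    ∃ φ : ℝ → ℝ, ContDiff ℝ ∞ φ ∧ HasCompactSupport φ ∧ tsupport φ ⊆ Set.Ioo 0 ℓ ∧
      deriv φ = ψ := by
  have hd : ∀ x, HasDerivAt (fun x => ∫ y in (0 : ℝ)..x, ψ y) (ψ x) x := fun x =>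
    intervalIntegral.integral_hasDerivAt_right (h1.continuous.intervalIntegrable _ _)
      (h1.continuous.stronglyMeasurableAtFilter _ _) h1.continuous.continuousAt
  have hderiv : deriv (fun x => ∫ y in (0 : ℝ)..x, ψ y) = ψ := funext fun x => (hd x).deriv
  -- The primitive from 0 vanishes to the left of a trivially, and to the right of b because the
  -- total integral is zero. If the support is empty, any a > 0 and b < ℓ will do, even with b < a.
  obtain ⟨a, b, ha, hb, hab⟩ : ∃ a b, 0 < a ∧ b < ℓ ∧ tsupport ψ ⊆ Set.Icc a b := by
    rcases (tsupport ψ).eq_empty_or_nonempty with h | h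
    · exact ⟨1, ℓ - 1, one_pos, by linarith, by simp [h]⟩
    · have hc : IsCompact (tsupport ψ) := h2
      exact ⟨sInf (tsupport ψ), sSup (tsupport ψ), (h3 (hc.sInf_mem h)).1,
        (h3 (hc.sSup_mem h)).2, fun x hx => ⟨csInf_le hc.bddBelow hx, le_csSup hc.bddAbove hx⟩⟩
  have hz : ∀ x, x ∉ Set.Icc a b → ψ x = 0 := fun x hx =>
    image_eq_zero_of_notMem_tsupport fun h => hx (hab h)
  have hsupp : tsupport (fun x => ∫ y in (0 : ℝ)..x, ψ y) ⊆ Set.Icc a b := by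
    refine closure_minimal (fun x hx => ?_) isClosed_Icc
    by_contra hx'
    apply hx
    rw [Set.mem_Icc, not_and_or, not_le, not_le] at hx'
    rcases hx' with h | h
    · refine intervalIntegral.integral_zero_ae (Filter.Eventually.of_forall fun y hy => hz y ?_)
      rcases Set.mem_uIoc.mp hy with hy | hy
      · exact fun h' => by linarith [h'.1, hy.2]
      · exact fun h' => by linarith [h'.1, hy.2]
    · have h4 : ∫ y in x..ℓ, ψ y = 0 := by
        refine intervalIntegral.integral_zero_ae (Filter.Eventually.of_forall fun y hy => hz y ?_)
        rcases Set.mem_uIoc.mp hy with hy | hy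
        · exact fun h' => by linarith [h'.2, hy.1]
        · exact fun h' => by linarith [h'.2, hy.1]
      have h5 := intervalIntegral.integral_add_adjacent_intervals
        (h1.continuous.intervalIntegrable (μ := volume) 0 x)
        (h1.continuous.intervalIntegrable (μ := volume) x ℓ)
      rw [h4, h0, add_zero] at h5
      exact h5
  refine ⟨fun x => ∫ y in (0 : ℝ)..x, ψ y, ?_, ?_, ?_, hderiv⟩
  · rw [contDiff_infty_iff_deriv]
    exact ⟨fun x => (hd x).differentiableAt, by rwa [hderiv]⟩
  · exact isCompact_Icc.of_isClosed_subset (isClosed_tsupport _) hsupp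
  · exact fun x hx => ⟨ha.trans_le (hsupp hx).1, (hsupp hx).2.trans_lt hb⟩

/-- A test function on `(0, ℓ)` with integral one. -/
theorem exists_contDiff_integral_eq_one {ℓ : ℝ} (hℓ : 0 < ℓ) :
    ∃ η : ℝ → ℝ, ContDiff ℝ ∞ η ∧ HasCompactSupport η ∧ tsupport η ⊆ Set.Ioo 0 ℓ ∧
      ∫ x in (0 : ℝ)..ℓ, η x = 1 := by
  let B : ContDiffBump (ℓ / 2) := ⟨ℓ / 8, ℓ / 4, by positivity, by linarith⟩
  have hB : tsupport (B.normed volume) ⊆ Set.Ioo 0 ℓ := by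
    rw [B.tsupport_normed_eq, Real.closedBall_eq_Icc]
    intro x hx
    have h1 : ℓ / 2 - ℓ / 4 ≤ x := hx.1
    have h2 : x ≤ ℓ / 2 + ℓ / 4 := hx.2
    exact ⟨by linarith, by linarith⟩
  refine ⟨B.normed volume, B.contDiff_normed, B.hasCompactSupport_normed, hB, ?_⟩
  rw [intervalIntegral.integral_of_le hℓ.le, ← integral_Icc_eq_integral_Ioc,
    setIntegral_eq_integral_of_forall_compl_eq_zero, B.integral_normed]
  intro x hx
  exact image_eq_zero_of_notMem_tsupport fun h => hx (Set.Ioo_subset_Icc_self (hB h))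

namespace MetricGraph

/-- **Du Bois-Reymond**: a continuous function on `[0, ℓ]` with weak derivative zero is constant. -/
theorem eqOn_const_of_integral_deriv_smul_eq_zero {ℓ : ℝ} (hℓ : 0 < ℓ) {v : ℝ → ℂ}
    (hv : Continuous v)
    (h : ∀ φ : ℝ → ℝ, ContDiff ℝ ∞ φ → HasCompactSupport φ → tsupport φ ⊆ Set.Ioo 0 ℓ →
      ∫ x in (0 : ℝ)..ℓ, deriv φ x • v x = 0) :
    ∀ x ∈ Set.Icc 0 ℓ, v x = v 0 := by
  obtain ⟨η, e1, e2, e3, e4⟩ := exists_contDiff_integral_eq_one hℓ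
  -- The constant must be this average of v, since η has integral one.
  set c : ℂ := ∫ x in (0 : ℝ)..ℓ, η x • v x with hc
  have key : ∀ᵐ x, x ∈ Set.Ioo 0 ℓ → v x - c = 0 := by
    refine isOpen_Ioo.ae_eq_zero_of_integral_contDiff_smul_eq_zero
      ((hv.sub continuous_const).locallyIntegrable.locallyIntegrableOn _) ?_
    intro ψ h1 h2 h3
    set m : ℝ := ∫ x in (0 : ℝ)..ℓ, ψ x with hm
    have h1' := h1.continuous
    have e1' := e1.continuous
    have i1 : ∀ {f : ℝ → ℝ}, Continuous f → IntervalIntegrable f volume 0 ℓ :=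
      fun hf => hf.intervalIntegrable _ _
    have i2 : ∀ {f : ℝ → ℂ}, Continuous f → IntervalIntegrable f volume 0 ℓ :=
      fun hf => hf.intervalIntegrable _ _
    have t3 : tsupport (fun x => ψ x - m * η x) ⊆ Set.Ioo 0 ℓ := by
      refine (tsupport_sub _ _).trans (Set.union_subset h3 ?_)
      exact (tsupport_mul_subset_right (f := fun _ => m) (g := η)).trans e3
    -- An arbitrary test function ψ is made a derivative by subtracting m η, which has the same
    -- integral m. The hypothesis then says that ∫ ψ v = m c, that is, ∫ ψ (v - c) = 0.
    obtain ⟨φ, p1, p2, p3, p4⟩ := exists_contDiff_deriv_eq_of_integral_eq_zero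
      (ψ := fun x => ψ x - m * η x) (h1.sub (contDiff_const.mul e1))
      (h2.sub e2.mul_left) t3 (by
        rw [intervalIntegral.integral_sub (i1 h1.continuous)
          (i1 (f := fun x => m * η x) (by fun_prop)), intervalIntegral.integral_const_mul, e4,
          mul_one, sub_self])
    have h5 := h φ p1 p2 p3
    rw [p4] at h5
    rw [← setIntegral_eq_integral_of_forall_compl_eq_zero (s := Set.Ioc 0 ℓ),
      ← intervalIntegral.integral_of_le hℓ.le]
    · have h6 : ∫ x in (0 : ℝ)..ℓ, ψ x • (v x - c) =
          (∫ x in (0 : ℝ)..ℓ, ψ x • v x) - m • c := by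
        simp only [smul_sub]
        rw [intervalIntegral.integral_sub (i2 (f := fun x => ψ x • v x) (by fun_prop))
          (i2 (f := fun x => ψ x • c) (by fun_prop)), intervalIntegral.integral_smul_const]
      have h7 : ∫ x in (0 : ℝ)..ℓ, (ψ x - m * η x) • v x =
          (∫ x in (0 : ℝ)..ℓ, ψ x • v x) - m • c := by
        simp only [sub_smul, mul_smul]
        rw [intervalIntegral.integral_sub (i2 (f := fun x => ψ x • v x) (by fun_prop))
          (i2 (f := fun x => m • η x • v x) (by fun_prop)), intervalIntegral.integral_smul]
      rw [h6, ← h7, h5]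
    · intro x hx
      rw [image_eq_zero_of_notMem_tsupport fun h' => hx (Set.Ioo_subset_Ioc_self (h3 h')),
        zero_smul]
  have hall : Set.EqOn v (fun _ => c) (Set.Icc 0 ℓ) := by
    refine Measure.eqOn_Icc_of_ae_eq volume hℓ.ne ?_ hv.continuousOn continuousOn_const
    rw [Filter.EventuallyEq, ← restrict_Ioo_eq_restrict_Icc, ae_restrict_iff' measurableSet_Ioo]
    filter_upwards [key] with x hx hx'
    exact sub_eq_zero.mp (hx hx')
  intro x hx
  rw [hall hx, hall (Set.left_mem_Icc.mpr hℓ.le)]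

end MetricGraph

/-! ### Continuous extensions, regularity, and the equation on one edge. -/

namespace MetricGraph

/-- Continuous functions that agree almost everywhere on a nondegenerate interval agree everywhere
on it. Thus the values at the ends of an edge do not depend on the chosen extension. -/
theorem IsContExt.eqOn {ℓ : ℝ} (hℓ : 0 < ℓ) {f : L2Edge ℓ} {u u' : ℝ → ℂ} (h : IsContExt f u)
    (h' : IsContExt f u') : Set.EqOn u u' (Set.Icc 0 ℓ) := by
  refine Measure.eqOn_Icc_of_ae_eq volume hℓ.ne ?_ h.1 h'.1
  rw [← restrict_Ioo_eq_restrict_Icc]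
  exact h.2.symm.trans h'.2

theorem IsContExt.congr {ℓ : ℝ} {f : L2Edge ℓ} {u u' : ℝ → ℂ} (h : IsContExt f u)
    (h' : Set.EqOn u' u (Set.Icc 0 ℓ)) : IsContExt f u' := by
  refine ⟨h.1.congr h', h.2.trans ?_⟩
  filter_upwards [ae_restrict_mem measurableSet_Ioo] with x hx
  exact (h' (Set.Ioo_subset_Icc_self hx)).symm

/-- Two functions with the same continuous extension are equal. -/
theorem IsContExt.unique {ℓ : ℝ} {f f' : L2Edge ℓ} {u : ℝ → ℂ} (h : IsContExt f u)
    (h' : IsContExt f' u) : f = f' :=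
  Lp.ext (h.2.trans h'.2.symm)

theorem exists_isContExt (ℓ : ℝ) {u : ℝ → ℂ} (hu : Continuous u) :
    ∃ f : L2Edge ℓ, IsContExt f u := by
  obtain ⟨C, hC⟩ := isCompact_Icc.exists_bound_of_continuousOn (hu.continuousOn (s := Set.Icc 0 ℓ))
  have h : MemLp u 2 ((volume : Measure ℝ).restrict (Set.Ioo 0 ℓ)) := by
    refine MemLp.of_bound hu.aestronglyMeasurable C ?_
    filter_upwards [ae_restrict_mem measurableSet_Ioo] with x hx
    exact hC x (Set.Ioo_subset_Icc_self hx)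
  exact ⟨h.toLp, hu.continuousOn, h.coeFn_toLp⟩

theorem IsContExt.setIntegral_smul {ℓ : ℝ} (hℓ : 0 < ℓ) {f : L2Edge ℓ} {u : ℝ → ℂ}
    (h : IsContExt f u) (φ : ℝ → ℝ) :
    ∫ x in Set.Ioo 0 ℓ, φ x • f x = ∫ x in (0 : ℝ)..ℓ, φ x • u x := by
  rw [intervalIntegral.integral_of_le hℓ.le, integral_Ioc_eq_integral_Ioo]
  refine integral_congr_ae ?_
  filter_upwards [h.2] with x hx
  rw [hx]

/-- Integration by parts; the boundary terms vanish because φ is zero at both ends. -/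
theorem integral_deriv_smul_eq_neg {ℓ : ℝ} {u w : ℝ → ℂ} (hu : ∀ x, HasDerivAt u (w x) x)
    (hw : Continuous w) {φ : ℝ → ℝ} (h1 : ContDiff ℝ ∞ φ) (h3 : tsupport φ ⊆ Set.Ioo 0 ℓ) :
    ∫ x in (0 : ℝ)..ℓ, deriv φ x • u x = -∫ x in (0 : ℝ)..ℓ, φ x • w x := by
  have hd : ∀ x, HasDerivAt φ (deriv φ x) x := fun x =>
    (h1.differentiable (by simp) x).hasDerivAt
  have h0 : φ 0 = 0 := image_eq_zero_of_notMem_tsupport fun h => lt_irrefl _ (h3 h).1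
  have hl : φ ℓ = 0 := image_eq_zero_of_notMem_tsupport fun h => lt_irrefl _ (h3 h).2
  have h := intervalIntegral.integral_smul_deriv_eq_deriv_smul (a := 0) (b := ℓ)
    (fun x _ => hd x) (fun x _ => hu x)
    ((h1.continuous_deriv (by simp)).intervalIntegrable _ _) (hw.intervalIntegrable _ _)
  rw [h, h0, hl]
  simp

theorem hasWeakDeriv_of_hasDerivAt {ℓ : ℝ} (hℓ : 0 < ℓ) {f g : L2Edge ℓ} {u w : ℝ → ℂ}
    (hf : IsContExt f u) (hg : IsContExt g w) (hu : ∀ x, HasDerivAt u (w x) x)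
    (hw : Continuous w) : HasWeakDeriv f g := by
  intro φ h1 _ h3
  rw [hf.setIntegral_smul hℓ, hg.setIntegral_smul hℓ, integral_deriv_smul_eq_neg hu hw h1 h3]

/-- A function with a weak derivative that is continuous up to the end points is continuously
differentiable up to the end points. -/
theorem HasWeakDeriv.hasDerivWithinAt {ℓ : ℝ} (hℓ : 0 < ℓ) {f g : L2Edge ℓ} {u w : ℝ → ℂ}
    (h : HasWeakDeriv f g) (hf : IsContExt f u) (hg : IsContExt g w) {x : ℝ}
    (hx : x ∈ Set.Icc 0 ℓ) : HasDerivWithinAt u (w x) (Set.Icc 0 ℓ) x := by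
  -- Clamping the argument to [0, ℓ] gives extensions continuous on all of ℝ, so that the primitive
  -- of w' is differentiable at the end points too.
  let u' : ℝ → ℂ := fun x => u (max 0 (min ℓ x))
  let w' : ℝ → ℂ := fun x => w (max 0 (min ℓ x))
  have hclamp : ∀ x, max 0 (min ℓ x) ∈ Set.Icc 0 ℓ := fun x =>
    ⟨le_max_left _ _, max_le hℓ.le (min_le_left _ _)⟩
  have hcont : Continuous fun x => max 0 (min ℓ x) := by fun_prop
  have hu'c : Continuous u' := hf.1.comp_continuous hcont hclamp
  have hw'c : Continuous w' := hg.1.comp_continuous hcont hclamp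
  have heq : ∀ y ∈ Set.Icc 0 ℓ, max 0 (min ℓ y) = y := fun y hy => by
    rw [min_eq_right hy.2, max_eq_right hy.1]
  have hu' : Set.EqOn u' u (Set.Icc 0 ℓ) := fun y hy => congrArg u (heq y hy)
  have hw' : Set.EqOn w' w (Set.Icc 0 ℓ) := fun y hy => congrArg w (heq y hy)
  have hd : ∀ y, HasDerivAt (fun y => ∫ z in (0 : ℝ)..y, w' z) (w' y) y := fun y =>
    intervalIntegral.integral_hasDerivAt_right (hw'c.intervalIntegrable _ _)
      (hw'c.stronglyMeasurableAtFilter _ _) hw'c.continuousAt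
  have hW : Continuous fun y => ∫ z in (0 : ℝ)..y, w' z :=
    continuous_iff_continuousAt.mpr fun y => (hd y).continuousAt
  -- The difference of u' and the primitive of w' has weak derivative zero.
  have hconst := eqOn_const_of_integral_deriv_smul_eq_zero
    (v := fun y => u' y - ∫ z in (0 : ℝ)..y, w' z) hℓ (hu'c.sub hW) (by
    intro φ h1 h2 h3
    have h4 := h φ h1 h2 h3
    rw [(hf.congr hu').setIntegral_smul hℓ, (hg.congr hw').setIntegral_smul hℓ,
      ← integral_deriv_smul_eq_neg hd hw'c h1 h3] at h4
    have hφ : Continuous (deriv φ) := h1.continuous_deriv (by simp)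
    simp only [smul_sub]
    rw [intervalIntegral.integral_sub
      (Continuous.intervalIntegrable (u := fun y => deriv φ y • u' y) (hφ.smul hu'c) _ _)
      (Continuous.intervalIntegrable (u := fun y => deriv φ y • ∫ z in (0 : ℝ)..y, w' z)
        (hφ.smul hW) _ _), h4, sub_self])
  have h5 : ∀ y ∈ Set.Icc 0 ℓ, u y = u' 0 + ∫ z in (0 : ℝ)..y, w' z := by
    intro y hy
    have h6 := hconst y hy
    simp only [intervalIntegral.integral_same, sub_zero, hu' hy] at h6
    rw [← h6]
    ring
  have h7 := ((hd x).const_add (u' 0)).hasDerivWithinAt (s := Set.Icc 0 ℓ)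
  rw [hw' hx] at h7
  exact h7.congr h5 (h5 x hx)

theorem hasDerivAt_ofReal_sin (κ x : ℝ) :
    HasDerivAt (fun x : ℝ => (Real.sin (κ * x) : ℂ)) ((κ : ℂ) * Real.cos (κ * x)) x := by
  have h := ((Real.hasDerivAt_sin (κ * x)).comp x ((hasDerivAt_id x).const_mul κ)).ofReal_comp
  convert! h using 1
  push_cast
  ring

theorem hasDerivAt_ofReal_cos (κ x : ℝ) :
    HasDerivAt (fun x : ℝ => (Real.cos (κ * x) : ℂ)) (-(κ : ℂ) * Real.sin (κ * x)) x := by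
  have h := ((Real.hasDerivAt_cos (κ * x)).comp x ((hasDerivAt_id x).const_mul κ)).ofReal_comp
  convert! h using 1
  push_cast
  ring

/-- The solutions of `u'' = -κ² u` on `[0, ℓ]` with `u 0 = 0`. -/
theorem eq_sin_of_hasDerivWithinAt {ℓ κ : ℝ} (hℓ : 0 < ℓ) {u w : ℝ → ℂ} (h0 : u 0 = 0)
    (hu : ∀ x ∈ Set.Icc 0 ℓ, HasDerivWithinAt u (w x) (Set.Icc 0 ℓ) x)
    (hw : ∀ x ∈ Set.Icc 0 ℓ, HasDerivWithinAt w (-(κ : ℂ) ^ 2 * u x) (Set.Icc 0 ℓ) x) :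
    ∀ x ∈ Set.Icc 0 ℓ,
      (κ : ℂ) * u x = w 0 * Real.sin (κ * x) ∧ w x = w 0 * Real.cos (κ * x) := by
  have hunique : ∀ x ∈ Set.Ico 0 ℓ, UniqueDiffWithinAt ℝ (Set.Icc 0 ℓ) x := fun x hx =>
    uniqueDiffOn_Icc hℓ x (Set.Ico_subset_Icc_self hx)
  have hsin := fun x => (hasDerivAt_ofReal_sin κ x).hasDerivWithinAt (s := Set.Icc 0 ℓ)
  have hcos := fun x => (hasDerivAt_ofReal_cos κ x).hasDerivWithinAt (s := Set.Icc 0 ℓ)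
  -- The flow of the equation rotates the vector (κu, w) by the angle κx. Rotating back gives two
  -- conserved quantities, with values 0 and w 0 at the left end; this avoids any uniqueness theorem
  -- for differential equations.
  have hA : ∀ x ∈ Set.Icc 0 ℓ, HasDerivWithinAt
      (fun x => (κ : ℂ) * u x * Real.cos (κ * x) - w x * Real.sin (κ * x)) 0
      (Set.Icc 0 ℓ) x := by
    intro x hx
    have h := (((hu x hx).const_mul (κ : ℂ)).mul (hcos x)).sub ((hw x hx).mul (hsin x))
    convert! h using 1
    ring
  have hB : ∀ x ∈ Set.Icc 0 ℓ, HasDerivWithinAt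
      (fun x => (κ : ℂ) * u x * Real.sin (κ * x) + w x * Real.cos (κ * x)) 0
      (Set.Icc 0 ℓ) x := by
    intro x hx
    have h := (((hu x hx).const_mul (κ : ℂ)).mul (hsin x)).add ((hw x hx).mul (hcos x))
    convert! h using 1
    ring
  have cA := constant_of_derivWithin_zero (fun x hx => (hA x hx).differentiableWithinAt)
    (fun x hx => (hA x (Set.Ico_subset_Icc_self hx)).derivWithin (hunique x hx))
  have cB := constant_of_derivWithin_zero (fun x hx => (hB x hx).differentiableWithinAt)
    (fun x hx => (hB x (Set.Ico_subset_Icc_self hx)).derivWithin (hunique x hx))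
  intro x hx
  have eA := cA x hx
  have eB := cB x hx
  simp only [h0, mul_zero, Real.sin_zero, Real.cos_zero, Complex.ofReal_zero, Complex.ofReal_one,
    sub_zero, zero_add, mul_one] at eA eB
  have hsq : (Real.sin (κ * x) : ℂ) ^ 2 + (Real.cos (κ * x) : ℂ) ^ 2 = 1 := by
    exact_mod_cast Real.sin_sq_add_cos_sq (κ * x)
  constructor
  · linear_combination (Real.cos (κ * x) : ℂ) * eA + (Real.sin (κ * x) : ℂ) * eB
      - (κ : ℂ) * u x * hsq
  · linear_combination (-(Real.sin (κ * x) : ℂ)) * eA + (Real.cos (κ * x) : ℂ) * eB - w x * hsq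

/-- This is where the edges of G_λ are singled out. The integer n in κℓ = nπ is positive because κℓ
is; for the same reason k = 0 never occurs. -/
theorem sin_mul_eq_zero_iff {κ ℓ : ℝ} (hκ : 0 < κ) (hℓ : 0 < ℓ) :
    Real.sin (κ * ℓ) = 0 ↔ ∃ k : ℕ, ℓ = k * (Real.pi / κ) := by
  rw [Real.sin_eq_zero_iff]
  constructor
  · rintro ⟨n, hn⟩
    have h1 : (0 : ℝ) < n := by
      have : 0 < (n : ℝ) * Real.pi := hn ▸ mul_pos hκ hℓ
      exact pos_of_mul_pos_left this Real.pi_pos.le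
    have h2 : 0 ≤ n := by exact_mod_cast h1.le
    lift n to ℕ using h2
    refine ⟨n, ?_⟩
    have hn' : (n : ℝ) * Real.pi = κ * ℓ := by exact_mod_cast hn
    field_simp
    linarith
  · rintro ⟨k, hk⟩
    refine ⟨k, ?_⟩
    rw [hk]
    push_cast
    field_simp

end MetricGraph

/-! ### The resonance space as the kernel of the signed incidence matrix. -/

namespace MetricGraph

variable {V E : Type*}

open scoped Classical in
theorem sum_filter_eq_sum_subtype [Fintype E] {M : Type*} [AddCommMonoid M] {p : E → Prop}
    [Fintype {e // p e}] (q : E → Prop) {F : E → M} (hF : ∀ e, ¬ p e → F e = 0) :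
    ∑ e with q e, F e = ∑ e : {e // p e} with q e.1, F e.1 := by
  rw [Finset.sum_filter, Finset.sum_filter,
    ← Finset.sum_subtype (Finset.univ.filter p) (by simp) fun e => if q e then F e else 0]
  refine (Finset.sum_subset (Finset.filter_subset _ _) fun e _ he => ?_).symm
  rw [hF e (by simpa using he), ite_self]

/-- The vertex conditions of functions which vanish outside the subgraph are those of the
subgraph. -/
theorem normalDeriv_eq_zero_iff_multipleSubgraph [Fintype E] (G : MetricGraph V E) (x : ℝ)
    [Fintype {e : E // ∃ k : ℕ, G.L e = k * x}] {w : E → ℝ → ℂ}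
    (hw : ∀ e, (¬ ∃ k : ℕ, G.L e = k * x) → w e 0 = 0 ∧ w e (G.L e) = 0) :
    (∀ v, G.normalDeriv w v = 0) ↔
      ∀ v, (G.multipleSubgraph x).normalDeriv (fun e => w e.1) v = 0 := by
  classical
  have h1 : ∀ v : {v : V // ∃ e, (∃ k : ℕ, G.L e = k * x) ∧ (G.o e = v ∨ G.t e = v)},
      G.normalDeriv w v = (G.multipleSubgraph x).normalDeriv (fun e => w e.1) v := by
    intro v
    rw [normalDeriv, normalDeriv, sum_filter_eq_sum_subtype (p := fun e => ∃ k : ℕ, G.L e = k * x)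
      (fun e => G.t e = v) fun e he => (hw e he).2,
      sum_filter_eq_sum_subtype (p := fun e => ∃ k : ℕ, G.L e = k * x)
      (fun e => G.o e = v) fun e he => (hw e he).1]
    simp only [multipleSubgraph, Subtype.ext_iff]
  refine ⟨fun h v => by rw [← h1, h], fun h v => ?_⟩
  by_cases hv : ∃ e, (∃ k : ℕ, G.L e = k * x) ∧ (G.o e = v ∨ G.t e = v)
  · rw [h1 ⟨v, hv⟩, h]
  -- Outside the subgraph, a vertex meets only edges on which w vanishes at both ends, so the
  -- condition there is void.
  · push Not at hv
    rw [normalDeriv, Finset.sum_eq_zero, Finset.sum_eq_zero, sub_zero]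
    · intro e he
      refine (hw e fun hk => ?_).1
      exact (hv e hk).1 (Finset.mem_filter.mp he).2
    · intro e he
      refine (hw e fun hk => ?_).2
      exact (hv e hk).2 (Finset.mem_filter.mp he).2

/-- The derivative of a_e sin(κx) is κ a_e at 0 and (-1)^{k_e} κ a_e at the other end, because
cos(kπ) = (-1)^k. -/
theorem normalDeriv_cos [Fintype E] (H : MetricGraph V E) {κ : ℝ} (hκ : κ ≠ 0) {k : E → ℕ}
    (hk : ∀ e, H.L e = k e * (Real.pi / κ)) (a : E → ℂ) (v : V) :
    H.normalDeriv (fun e x => a e * (κ * Real.cos (κ * x))) v =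
      κ * (H.signedIncidence fun e => (-1) ^ k e).mulVec a v := by
  have hcos : ∀ e, Real.cos (κ * H.L e) = (-1) ^ k e := by
    intro e
    rw [hk, ← Real.cos_nat_mul_pi]
    congr 1
    field_simp
  rw [normalDeriv, signedIncidence_mulVec, mul_sub, Finset.mul_sum, Finset.mul_sum]
  congr 1
  · refine Finset.sum_congr rfl fun e _ => ?_
    rw [hcos]
    push_cast
    ring
  · refine Finset.sum_congr rfl fun e _ => ?_
    simp
    ring

/-- The extension witnessing the domain and the one witnessing the zeros agree on closed edges, so a
single u serves for both. -/
theorem mem_resonanceSpace_iff [Fintype E] {G : MetricGraph V E} {lam : ℝ} {f : G.L2} :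
    f ∈ G.resonanceSpace lam ↔
      ∃ g u w, G.IsKirchhoff f ((lam : ℂ) • f) g u w ∧ ∀ e, u e 0 = 0 ∧ u e (G.L e) = 0 := by
  have h1 : f ∈ G.eigenspace lam ↔ (f, (lam : ℂ) • f) ∈ G.laplacianGraph := by
    rw [← negLaplacian_graph, LinearPMap.mem_graph_iff]
    constructor
    · rintro ⟨hf, h⟩
      exact ⟨⟨f, hf⟩, rfl, h⟩
    · rintro ⟨⟨y, hy⟩, rfl, h⟩
      exact ⟨hy, h⟩
  rw [resonanceSpace, Submodule.mem_inf, h1]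
  constructor
  · rintro ⟨⟨g, u, w, H⟩, u', hu', h0⟩
    refine ⟨g, u, w, H, fun e => ?_⟩
    have h2 := (H.contExt_fst e).eqOn (G.L_pos e) (hu' e)
    rw [h2 (Set.left_mem_Icc.mpr (G.L_pos e).le), h2 (Set.right_mem_Icc.mpr (G.L_pos e).le)]
    exact h0 e
  · rintro ⟨g, u, w, H, h0⟩
    exact ⟨⟨g, u, w, H⟩, u, H.contExt_fst, h0⟩

open scoped Classical in
/-- The function on `G` which is `a e • S e` on the edges with property `p`, and zero on the other
edges. -/
noncomputable def edgeCombination (G : MetricGraph V E) (p : E → Prop) (S : ∀ e, L2Edge (G.L e)) :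
    ({e // p e} → ℂ) →ₗ[ℂ] G.L2 :=
  (WithLp.linearEquiv 2 ℂ (∀ e, L2Edge (G.L e))).symm.toLinearMap ∘ₗ
    LinearMap.pi fun e => if h : p e then (LinearMap.proj ⟨e, h⟩).smulRight (S e) else 0

open scoped Classical in
theorem edgeCombination_apply (G : MetricGraph V E) (p : E → Prop) (S : ∀ e, L2Edge (G.L e))
    (a : {e // p e} → ℂ) (e : E) :
    G.edgeCombination p S a e = (if h : p e then a ⟨e, h⟩ else 0) • S e := by
  by_cases h : p e <;> simp [edgeCombination, h]

theorem edgeCombination_injective (G : MetricGraph V E) {p : E → Prop}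
    {S : ∀ e, L2Edge (G.L e)} (hS : ∀ e, p e → S e ≠ 0) :
    Function.Injective (G.edgeCombination p S) := by
  rw [← LinearMap.ker_eq_bot, LinearMap.ker_eq_bot']
  intro a ha
  ext ⟨e, he⟩
  have h1 : G.edgeCombination p S a e = 0 := by rw [ha]; rfl
  rw [edgeCombination_apply, dif_pos he] at h1
  exact (smul_eq_zero.mp h1).resolve_right (hS e he)

theorem ne_zero_of_isContExt_sin {ℓ κ : ℝ} (hℓ : 0 < ℓ) (hκ : 0 < κ)
    {S : L2Edge ℓ} (hS : IsContExt S fun x => (Real.sin (κ * x) : ℂ)) : S ≠ 0 := by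
  rintro rfl
  -- A point of the edge with 0 < κy ≤ π/2, where the sine is positive.
  set y := min ℓ (Real.pi / (2 * κ)) with hy
  have hpi := Real.pi_pos
  have hy0 : 0 < y := lt_min hℓ (by positivity)
  have h1 := hS.eqOn hℓ isContExt_zero (x := y) ⟨hy0.le, min_le_left _ _⟩
  have h2 : 0 < Real.sin (κ * y) := by
    refine Real.sin_pos_of_pos_of_lt_pi (mul_pos hκ hy0) ?_
    calc κ * y ≤ κ * (Real.pi / (2 * κ)) := by gcongr; exact min_le_right _ _
      _ = Real.pi / 2 := by field_simp
      _ < Real.pi := by linarith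
  exact h2.ne' (Complex.ofReal_eq_zero.mp h1)

/-- The resonance space is parametrized by the kernel of a signed incidence matrix of the
subgraph. -/
theorem resonanceSpace_eq_map [Fintype E] (G : MetricGraph V E) {κ : ℝ} (hκ : 0 < κ)
    [Fintype {e : E // ∃ k : ℕ, G.L e = k * (Real.pi / κ)}]
    {k : {e : E // ∃ k : ℕ, G.L e = k * (Real.pi / κ)} → ℕ}
    (hk : ∀ e, G.L e.1 = k e * (Real.pi / κ)) {S : ∀ e, L2Edge (G.L e)}
    (hS : ∀ e, IsContExt (S e) fun x => (Real.sin (κ * x) : ℂ)) :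
    G.resonanceSpace (κ ^ 2) =
      (LinearMap.ker ((G.multipleSubgraph (Real.pi / κ)).signedIncidence
        fun e => (-1) ^ k e).mulVecLin).map
        (G.edgeCombination (fun e => ∃ k : ℕ, G.L e = k * (Real.pi / κ)) S) := by
  classical
  have hκ' : (κ : ℂ) ≠ 0 := by exact_mod_cast hκ.ne'
  have hker : ∀ b : E → ℂ, (∀ e, (¬ ∃ k : ℕ, G.L e = k * (Real.pi / κ)) → b e = 0) →
      ((∀ v, G.normalDeriv (fun e x => b e * (κ * Real.cos (κ * x))) v = 0) ↔
        (fun e : {e : E // ∃ k : ℕ, G.L e = k * (Real.pi / κ)} => b e.1) ∈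
          LinearMap.ker ((G.multipleSubgraph (Real.pi / κ)).signedIncidence
            fun e => (-1) ^ k e).mulVecLin) := by
    intro b hb
    rw [normalDeriv_eq_zero_iff_multipleSubgraph G (Real.pi / κ) fun e he => by simp [hb e he],
      LinearMap.mem_ker, Matrix.mulVecLin_apply, funext_iff]
    refine forall_congr' fun v => ?_
    rw [normalDeriv_cos (G.multipleSubgraph (Real.pi / κ)) hκ.ne' hk fun e => b e.1]
    simp [hκ']
  ext f
  rw [mem_resonanceSpace_iff, Submodule.mem_map]
  constructor
  · rintro ⟨g, u, w, H, h0⟩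
    have hsolve : ∀ e, ∀ x ∈ Set.Icc 0 (G.L e), (κ : ℂ) * u e x = w e 0 * Real.sin (κ * x) ∧
        w e x = w e 0 * Real.cos (κ * x) := by
      intro e
      refine eq_sin_of_hasDerivWithinAt (G.L_pos e) (h0 e).1
        (fun x hx => (H.deriv_fst e).hasDerivWithinAt (G.L_pos e) (H.contExt_fst e)
          (H.contExt_snd e) hx) fun x hx => ?_
      have h1 : IsContExt (-(((κ ^ 2 : ℝ) : ℂ) • f) e) ((-(κ : ℂ) ^ 2) • u e) := by
        have h2 := (H.contExt_fst e).smul (-(κ : ℂ) ^ 2)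
        rw [PiLp.smul_apply, ← neg_smul]
        push_cast
        exact h2
      exact (H.deriv_snd e).hasDerivWithinAt (G.L_pos e) (H.contExt_snd e) h1 hx
    -- The amplitude, read off from κu = w(0) sin(κx). On an edge outside G_λ the sine is nonzero at
    -- the far end, so u(L) = 0 forces w(0) = 0.
    let b : E → ℂ := fun e => w e 0 / κ
    have hb : ∀ e, (¬ ∃ k : ℕ, G.L e = k * (Real.pi / κ)) → b e = 0 := by
      intro e he
      have h1 := (hsolve e (G.L e) (Set.right_mem_Icc.mpr (G.L_pos e).le)).1
      rw [(h0 e).2, mul_zero, zero_eq_mul, Complex.ofReal_eq_zero,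
        sin_mul_eq_zero_iff hκ (G.L_pos e)] at h1
      simp [b, h1.resolve_right he]
    refine ⟨fun e => b e.1, (hker b hb).mp fun v => ?_, ?_⟩
    · rw [← H.kirchhoff v, normalDeriv, normalDeriv]
      congr 1
      · refine Finset.sum_congr rfl fun e _ => ?_
        rw [(hsolve e (G.L e) (Set.right_mem_Icc.mpr (G.L_pos e).le)).2]
        simp only [b]
        field_simp
      · refine Finset.sum_congr rfl fun e _ => ?_
        simp only [b, mul_zero, Real.cos_zero, Complex.ofReal_one]
        field_simp
    · refine PiLp.ext fun e => ?_
      rw [edgeCombination_apply]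
      have h1 : (if h : ∃ k : ℕ, G.L e = k * (Real.pi / κ) then b e else 0) = b e := by
        split_ifs with h
        · rfl
        · exact (hb e h).symm
      rw [h1]
      refine IsContExt.unique ((hS e).smul (b e)) ((H.contExt_fst e).congr fun x hx => ?_)
      have h2 := (hsolve e x hx).1
      simp only [Pi.smul_apply, smul_eq_mul, b]
      field_simp
      linear_combination -h2
  · rintro ⟨a, ha, rfl⟩
    let b : E → ℂ := fun e =>
      if h : ∃ k : ℕ, G.L e = k * (Real.pi / κ) then a ⟨e, h⟩ else 0
    have hb : ∀ e, (¬ ∃ k : ℕ, G.L e = k * (Real.pi / κ)) → b e = 0 := fun e he => dif_neg he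
    have hba : (fun e : {e : E // ∃ k : ℕ, G.L e = k * (Real.pi / κ)} => b e.1) = a :=
      funext fun e => dif_pos e.2
    have hf : ∀ e, G.edgeCombination (fun e => ∃ k : ℕ, G.L e = k * (Real.pi / κ)) S a e =
        b e • S e := fun e => edgeCombination_apply _ _ _ _ _
    have hcos : Continuous fun x : ℝ => (κ : ℂ) * (Real.cos (κ * x) : ℂ) := by fun_prop
    -- The L² class of κ cos(κx), the derivative of the sine on each edge.
    choose C hC using fun e => exists_isContExt (G.L e) hcos
    have hu : ∀ e, b e * (Real.sin (κ * 0) : ℂ) = 0 ∧ b e * (Real.sin (κ * G.L e) : ℂ) = 0 := by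
      intro e
      refine ⟨by simp, ?_⟩
      by_cases he : ∃ k : ℕ, G.L e = k * (Real.pi / κ)
      · rw [(sin_mul_eq_zero_iff hκ (G.L_pos e)).mpr he]
        simp
      · rw [hb e he, zero_mul]
    refine ⟨WithLp.toLp 2 fun e => b e • C e, fun e x => b e * Real.sin (κ * x),
      fun e x => b e * (κ * Real.cos (κ * x)), ⟨fun e => ?_, fun e => ?_, fun e => ?_,
        fun e => ?_, ⟨0, fun e => hu e⟩, (hker b hb).mpr (hba ▸ ha)⟩, hu⟩
    · rw [hf]
      exact (hasWeakDeriv_of_hasDerivAt (G.L_pos e) (hS e) (hC e) (hasDerivAt_ofReal_sin κ)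
        hcos).smul (b e)
    · rw [PiLp.smul_apply, hf]
      have h1 : IsContExt (-(κ : ℂ) ^ 2 • S e)
          fun x => (κ : ℂ) * (-(κ : ℂ) * Real.sin (κ * x)) := by
        refine ((hS e).smul (-(κ : ℂ) ^ 2)).congr fun x _ => ?_
        simp only [Pi.smul_apply, smul_eq_mul]
        ring
      have h2 := (hasWeakDeriv_of_hasDerivAt (G.L_pos e) (hC e) h1
        (fun x => (hasDerivAt_ofReal_cos κ x).const_mul (κ : ℂ)) (by fun_prop)).smul (b e)
      convert! h2 using 1
      rw [neg_smul, smul_neg, smul_comm]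
      push_cast
      rfl
    · rw [hf]
      exact (hS e).smul (b e)
    · exact (hC e).smul (b e)

end MetricGraph

theorem theorem3p1 {V E : Type*} [Finite V] [Fintype E] (G : MetricGraph V E)
    (lam : ℝ) (hlam : 0 < lam) :
    FiniteDimensional ℂ (G.resonanceSpace lam) ∧
    (Module.finrank ℂ (G.resonanceSpace lam) : ℤ) =
      (G.multipleSubgraph (Real.pi / √lam)).betti1 -
        (G.multipleSubgraph (Real.pi / √lam)).betti0Odd (Real.pi / √lam) ∧
    (G.IsResonance lam ↔
      0 < (G.multipleSubgraph (Real.pi / √lam)).betti1 -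
        (G.multipleSubgraph (Real.pi / √lam)).betti0Odd (Real.pi / √lam)) := by
  have hκ : 0 < √lam := Real.sqrt_pos.mpr hlam
  have := Fintype.ofFinite {e : E // ∃ k : ℕ, G.L e = k * (Real.pi / √lam)}
  choose k hk using fun e : {e : E // ∃ k : ℕ, G.L e = k * (Real.pi / √lam)} => e.2
  have hsin : Continuous fun x : ℝ => (Real.sin (√lam * x) : ℂ) := by fun_prop
  choose S hS using fun e => MetricGraph.exists_isContExt (G.L e) hsin
  have hmap := MetricGraph.resonanceSpace_eq_map G hκ hk hS
  rw [Real.sq_sqrt hlam.le] at hmap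
  have hfin : FiniteDimensional ℂ (G.resonanceSpace lam) := by
    rw [hmap]
    infer_instance
  have hdim : (Module.finrank ℂ (G.resonanceSpace lam) : ℤ) =
      (G.multipleSubgraph (Real.pi / √lam)).betti1 -
        (G.multipleSubgraph (Real.pi / √lam)).betti0Odd (Real.pi / √lam) := by
    rw [← MetricGraph.finrank_ker_signedIncidence_neg_one_pow (G.multipleSubgraph (Real.pi / √lam))
      (div_pos Real.pi_pos hκ).ne' hk, hmap]
    -- The parametrization by amplitudes is injective because the sine is nonzero in L² of each
    -- edge, so it preserves the dimension of the kernel.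
    exact_mod_cast (Submodule.equivMapOfInjective _ (MetricGraph.edgeCombination_injective G fun e _ =>
      MetricGraph.ne_zero_of_isContExt_sin (G.L_pos e) hκ (hS e)) _).finrank_eq.symm
  refine ⟨hfin, hdim, ?_⟩
  rw [← hdim, Nat.cast_pos, Module.finrank_pos_iff_exists_ne_zero, MetricGraph.IsResonance]
  constructor
  · rintro ⟨f, hf, h0⟩
    exact ⟨⟨f, hf⟩, fun h => h0 (congrArg Subtype.val h)⟩
  · rintro ⟨f, h0⟩
    exact ⟨f.1, f.2, fun h => h0 (Subtype.ext h)⟩
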